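/- **Definitions.** Let $\bar M$ be a smooth manifold of dimension $2n+s$ with Riemannian metric $\bar g$ and Levi-Civita connection $\bar\nabla$. A *metric $f$-structure* on $\bar M$ consists of a $(1,1)$-tensor field $\varphi$, vector fields $\xi_1,\dots,\xi_s$ and $1$-forms $\eta^1,\dots,\eta^s$ (all smooth) such that, for all tangent vectors $X,Y$ and all $i,j$, $$\varphi^2=-I+\sum_{i=1}^s\eta^i\otimes\xi_i,\qquad \eta^i(\xi_j)=\delta_{ij},\qquad \bar g(\varphi X,\varphi Y)=\bar g(X,Y)-\sum_{i=1}^s\eta^i(X)\eta^i(Y),$$ $$\eta^i(X)=\bar g(X,\xi_i),\qquad \bar g(X,\varphi Y)=-\bar g(\varphi X,Y),\qquad \varphi\xi_i=0,\qquad \eta^i\circ\varphi=0 .$$ Its fundamental $2$-form is $\Phi(X,Y)=\bar g(X,\varphi Y)$. The manifold $\bar M$ with this structure is a *generalized Kenmotsu manifold* if $\eta^1\wedge\dots\wedge\eta^s\wedge\Phi^n$ vanishes nowhere, $d\eta^i=0$ for all $i$, $d\Phi=2\sum_{i=1}^s\eta^i\wedge\Phi$, and the structure is normal, i.e. $[\varphi,\varphi]+2\sum_{i=1}^s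 d\eta^i\otimes\xi_i=0$, where $[\varphi,\varphi]$ is the Nijenhuis tensor of $\varphi$. Let $M$ be an (immersed) submanifold of $\bar M$ with the induced metric $g$ and its Levi-Civita connection $\nabla$. Its second fundamental form $h$ is defined by the Gauss formula $\bar\nabla_XY=\nabla_XY+h(X,Y)$ for vector fields $X,Y$ tangent to $M$. The submanifold is *invariant* if $\varphi(T_xM)\subset T_xM$ for all $x\in M$ and all $\xi_i$ are tangent to $M$. **Theorem.** Let $M$ be an invariant submanifold of a generalized Kenmotsu manifold $\bar M$ of dimension $2n+s$. Then, for every smooth vector field $X$ tangent to $M$ and every $j\in\{1,\dots,s\}$, $$\nabla_X\xi_j=-\varphi^2X,\qquad h(X,\xi_j)=0,\qquad h(\xi_j,X)=0 .$$ -/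

import Mathlib

open Bundle Manifold VectorField
open scoped ContDiff Topology

section LeviCivita

variable {E : Type*} [NormedAddCommGroup E] [NormedSpace ℝ E]
  {H : Type*} [TopologicalSpace H] {I : ModelWithCorners ℝ E H}
  {M : Type*} [TopologicalSpace M] [ChartedSpace H M] [IsManifold I ∞ M]

variable (I M) in
/-- A smooth Riemannian metric on a manifold. -/
abbrev RiemMetric := ContMDiffRiemannianMetric I ∞ E (fun x : M => TangentSpace I x)

theorem RiemMetric.mdifferentiableAt_inner (g : RiemMetric I M) {X Y : Π x : M, TangentSpace I x}
    {x : M} (hX : MDiffAt (T% X) x) (hY : MDiffAt (T% Y) x) :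
    MDiffAt (fun y => g.inner y (X y) (Y y)) x := by
  have : MDifferentiableAt I (I.prod 𝓘(ℝ))
      (fun m ↦ TotalSpace.mk' ℝ (E := Bundle.Trivial M ℝ) m (g.inner m (X m) (Y m))) x := by
    apply MDifferentiableAt.clm_bundle_apply₂ (F₁ := E) (F₂ := E)
    · exact g.contMDiff.mdifferentiableAt (by simp)
    · exact hX
    · exact hY
  simp only [mdifferentiableAt_totalSpace] at this
  exact this.2

/-- Koszul's expression; it equals `2 ⟨∇_X Y, Z⟩` at `x`. -/
noncomputable def RiemMetric.koszul (g : RiemMetric I M) (Y X Z : Π x : M, TangentSpace I x)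
    (x : M) : ℝ :=
  mvfderiv I (fun y => g.inner y (Y y) (Z y)) x (X x)
    + mvfderiv I (fun y => g.inner y (X y) (Z y)) x (Y x)
    - mvfderiv I (fun y => g.inner y (X y) (Y y)) x (Z x)
    + g.inner x (mlieBracket I X Y x) (Z x)
    - g.inner x (mlieBracket I X Z x) (Y x)
    - g.inner x (mlieBracket I Y Z x) (X x)

/-- The scalar product of a tangent space as a bilinear form. -/
noncomputable def RiemMetric.bilin (g : RiemMetric I M) (x : M) :
    LinearMap.BilinForm ℝ (TangentSpace I x) :=
  (ContinuousLinearMap.coeLM ℝ).comp (g.inner x).toLinearMap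

theorem RiemMetric.bilin_nondegenerate (g : RiemMetric I M) (x : M) : (g.bilin x).Nondegenerate := by
  constructor
  · intro v hv
    by_contra hne
    exact (g.pos x v hne).ne' (hv v)
  · intro v hv
    by_contra hne
    exact (g.pos x v hne).ne' (hv v)

theorem RiemMetric.ext_inner (g : RiemMetric I M) {x : M} {v w : TangentSpace I x}
    (h : ∀ z, g.inner x v z = g.inner x w z) : v = w := by
  by_contra hne
  refine (g.pos x (v - w) (sub_ne_zero.2 hne)).ne' ?_
  simp [h]

theorem RiemMetric.leviCivitaFun_ext (g : RiemMetric I M) {x : M}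
    {A B : TangentSpace I x →L[ℝ] TangentSpace I x}
    (h : ∀ X Z : Π x : M, TangentSpace I x, MDiffAt (T% X) x → MDiffAt (T% Z) x →
      g.inner x (A (X x)) (Z x) = g.inner x (B (X x)) (Z x)) : A = B := by
  ext u
  refine g.ext_inner fun z => ?_
  simpa using h (FiberBundle.extend E u) (FiberBundle.extend E z)
    (FiberBundle.mdifferentiableAt_extend ..) (FiberBundle.mdifferentiableAt_extend ..)

variable [FiniteDimensional ℝ E]

theorem RiemMetric.koszul_tensorial_left (g : RiemMetric I M) {Y Z : Π x : M, TangentSpace I x}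
    {x : M} (hY : MDiffAt (T% Y) x) (hZ : MDiffAt (T% Z) x) :
    TensorialAt I E (fun X => g.koszul Y X Z x) x where
  smul {f X} hf hX := by
    have := FiniteDimensional.complete ℝ E
    simp [koszul, mlieBracket_smul_left hf hX,
      mvfderiv_fun_mul hf (g.mdifferentiableAt_inner hX hZ),
      mvfderiv_fun_mul hf (g.mdifferentiableAt_inner hX hY)]
    ring
  add {X X'} hX hX' := by
    have := FiniteDimensional.complete ℝ E
    simp [koszul, mlieBracket_add_left hX hX',
      mvfderiv_fun_add (g.mdifferentiableAt_inner hX hZ) (g.mdifferentiableAt_inner hX' hZ),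
      mvfderiv_fun_add (g.mdifferentiableAt_inner hX hY) (g.mdifferentiableAt_inner hX' hY)]
    ring

theorem RiemMetric.koszul_tensorial_right (g : RiemMetric I M) {Y X : Π x : M, TangentSpace I x}
    {x : M} (hY : MDiffAt (T% Y) x) (hX : MDiffAt (T% X) x) :
    TensorialAt I E (fun Z => g.koszul Y X Z x) x where
  smul {f Z} hf hZ := by
    have := FiniteDimensional.complete ℝ E
    simp [koszul, mlieBracket_smul_right hf hZ,
      mvfderiv_fun_mul hf (g.mdifferentiableAt_inner hX hZ),
      mvfderiv_fun_mul hf (g.mdifferentiableAt_inner hY hZ)]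
    rw [g.symm x (Z x) (X x), g.symm x (Z x) (Y x)]
    ring
  add {Z Z'} hZ hZ' := by
    have := FiniteDimensional.complete ℝ E
    simp [koszul, mlieBracket_add_right hZ hZ',
      mvfderiv_fun_add (g.mdifferentiableAt_inner hX hZ) (g.mdifferentiableAt_inner hX hZ'),
      mvfderiv_fun_add (g.mdifferentiableAt_inner hY hZ) (g.mdifferentiableAt_inner hY hZ')]
    ring

instance tangentSpace_finiteDimensional (x : M) : FiniteDimensional ℝ (TangentSpace I x) :=
  inferInstanceAs (FiniteDimensional ℝ E)

instance tangentSpace_t2Space (x : M) : T2Space (TangentSpace I x) :=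
  inferInstanceAs (T2Space E)

open scoped Classical in
/-- Koszul's formula: `∇Y` at `x` is the linear map `u ↦ w`, where
`2 ⟨w, z⟩ = koszul Y u z` for all `z` (and `0`, by convention, if `Y` is not differentiable). -/
noncomputable def RiemMetric.leviCivitaFun (g : RiemMetric I M) (Y : Π x : M, TangentSpace I x)
    (x : M) : TangentSpace I x →L[ℝ] TangentSpace I x :=
  if hY : MDiffAt (T% Y) x then
    LinearMap.toContinuousLinearMap
      (((g.bilin x).toDual (g.bilin_nondegenerate x)).symm.toLinearMap ∘ₗ
        ContinuousLinearMap.coeLM ℝ ∘ₗ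
        ((1 / 2 : ℝ) • TensorialAt.mkHom₂ (fun X Z => g.koszul Y X Z x) x
          (fun _ hZ => g.koszul_tensorial_left hY hZ)
          (fun _ hX => g.koszul_tensorial_right hY hX)).toLinearMap)
  else 0

theorem RiemMetric.leviCivitaFun_inner (g : RiemMetric I M) {X Y Z : Π x : M, TangentSpace I x}
    {x : M} (hX : MDiffAt (T% X) x) (hY : MDiffAt (T% Y) x) (hZ : MDiffAt (T% Z) x) :
    g.inner x (g.leviCivitaFun Y x (X x)) (Z x) = (1 / 2 : ℝ) * g.koszul Y X Z x := by
  have h1 (φ : Module.Dual ℝ (TangentSpace I x)) (z : TangentSpace I x) :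
      g.inner x (((g.bilin x).toDual (g.bilin_nondegenerate x)).symm φ) z = φ z :=
    LinearMap.BilinForm.apply_toDual_symm_apply (hB := g.bilin_nondegenerate x) φ z
  rw [leviCivitaFun, dif_pos hY]
  simp only [LinearMap.coe_toContinuousLinearMap', LinearMap.comp_apply, LinearEquiv.coe_coe, h1]
  simp [TensorialAt.mkHom₂_apply (fun _ hZ => g.koszul_tensorial_left hY hZ)
          (fun _ hX => g.koszul_tensorial_right hY hX) hX hZ]

/-- The Levi-Civita connection of a Riemannian metric: `g.leviCivita Y x u` is `∇_u Y` at `x`. -/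
noncomputable def RiemMetric.leviCivita (g : RiemMetric I M) :
    CovariantDerivative I E (fun x : M => TangentSpace I x) where
  toFun := g.leviCivitaFun
  isCovariantDerivativeOnUniv :=
    { add := by
        intro Y Y' x hY hY' _
        have := FiniteDimensional.complete ℝ E
        refine g.leviCivitaFun_ext fun X Z hX hZ => ?_
        have hYY : MDiffAt (T% (Y + Y')) x := mdifferentiableAt_add_section hY hY'
        rw [g.leviCivitaFun_inner hX hYY hZ, add_apply, map_add, add_apply,
          g.leviCivitaFun_inner hX hY hZ, g.leviCivitaFun_inner hX hY' hZ]
        simp [koszul, mlieBracket_add_left hY hY', mlieBracket_add_right hY hY',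
          mvfderiv_fun_add (g.mdifferentiableAt_inner hX hY) (g.mdifferentiableAt_inner hX hY'),
          mvfderiv_fun_add (g.mdifferentiableAt_inner hY hZ) (g.mdifferentiableAt_inner hY' hZ)]
        ring
      leibniz := by
        intro Y f x hY hf _
        have := FiniteDimensional.complete ℝ E
        refine g.leviCivitaFun_ext fun X Z hX hZ => ?_
        have hfY : MDiffAt (T% (f • Y)) x := hf.smul_section hY
        rw [g.leviCivitaFun_inner hX hfY hZ, add_apply, map_add, add_apply, smul_apply, map_smul,
          smul_apply, g.leviCivitaFun_inner hX hY hZ]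
        simp [koszul, mlieBracket_smul_left hf hY, mlieBracket_smul_right hf hY,
          mvfderiv_fun_mul hf (g.mdifferentiableAt_inner hX hY),
          mvfderiv_fun_mul hf (g.mdifferentiableAt_inner hY hZ)]
        rw [g.symm x (Y x) (X x)]
        ring }

/-- The Levi-Civita connection is compatible with the metric. -/
theorem RiemMetric.leviCivita_metric (g : RiemMetric I M) {X Y Z : Π x : M, TangentSpace I x}
    {x : M} (hX : MDiffAt (T% X) x) (hY : MDiffAt (T% Y) x) (hZ : MDiffAt (T% Z) x) :
    mvfderiv I (fun y => g.inner y (Y y) (Z y)) x (X x)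
      = g.inner x (g.leviCivita Y x (X x)) (Z x) + g.inner x (Y x) (g.leviCivita Z x (X x)) := by
  change _ = g.inner x (g.leviCivitaFun Y x (X x)) (Z x) + g.inner x (Y x) (g.leviCivitaFun Z x (X x))
  rw [g.symm x (Y x), g.leviCivitaFun_inner hX hY hZ, g.leviCivitaFun_inner hX hZ hY, koszul, koszul,
    mlieBracket_swap_apply (V := Z) (W := Y)]
  simp only [g.symm _ (Z _) (Y _), map_neg, neg_apply]
  ring

/-- The Levi-Civita connection has no torsion. -/
theorem RiemMetric.leviCivita_torsion (g : RiemMetric I M) : g.leviCivita.torsion = 0 := by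
  rw [CovariantDerivative.torsion_eq_zero_iff]
  intro X Y x hX hY
  refine g.ext_inner fun z => ?_
  have hZ := FiberBundle.mdifferentiableAt_extend (I := I) (F := E) z
  have h1 := g.leviCivitaFun_inner hX hY hZ
  have h2 := g.leviCivitaFun_inner hY hX hZ
  rw [FiberBundle.extend_apply_self] at h1 h2
  change g.inner x (g.leviCivitaFun Y x (X x) - g.leviCivitaFun X x (Y x)) z = _
  rw [map_sub, sub_apply, h1, h2, koszul, koszul, mlieBracket_swap_apply (V := Y) (W := X)]
  simp only [g.symm _ (Y _) (X _), map_neg, neg_apply, FiberBundle.extend_apply_self]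
  ring

end LeviCivita

section ExteriorCalculus

variable {E : Type*} [NormedAddCommGroup E] [NormedSpace ℝ E]
  {H : Type*} [TopologicalSpace H] (I : ModelWithCorners ℝ E H)
  {M : Type*} [TopologicalSpace M] [ChartedSpace H M] [IsManifold I ∞ M]

/-- Smoothness of a vector field at a point. -/
def SmoothFieldAt (X : Π x : M, TangentSpace I x) (x : M) : Prop :=
  ContMDiffAt I (I.prod 𝓘(ℝ, E)) ∞ (fun y => TotalSpace.mk' E y (X y)) x

/- Exterior derivative and wedge product carry the factors `1 / (p + 1)` and `1 / (p + q)!` that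
go with the normality condition `[φ, φ] + 2 ∑ dηⁱ ⊗ ξᵢ = 0`. -/

/-- The exterior derivative of a 1-form,
`2 dα(X, Y) = X (α Y) - Y (α X) - α [X, Y]`. -/
noncomputable def extDerivOne (α : Π x : M, TangentSpace I x →L[ℝ] ℝ)
    (X Y : Π x : M, TangentSpace I x) (x : M) : ℝ :=
  (1 / 2) * (mvfderiv I (fun y => α y (Y y)) x (X x) - mvfderiv I (fun y => α y (X y)) x (Y x)
    - α x (mlieBracket I X Y x))

/-- The exterior derivative of a 2-form, `3 dβ(X, Y, Z) =
X β(Y, Z) + Y β(Z, X) + Z β(X, Y) - β([X, Y], Z) - β([Y, Z], X) - β([Z, X], Y)`. -/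
noncomputable def extDerivTwo (β : Π x : M, TangentSpace I x → TangentSpace I x → ℝ)
    (X Y Z : Π x : M, TangentSpace I x) (x : M) : ℝ :=
  (1 / 3) * (mvfderiv I (fun y => β y (Y y) (Z y)) x (X x)
    + mvfderiv I (fun y => β y (Z y) (X y)) x (Y x)
    + mvfderiv I (fun y => β y (X y) (Y y)) x (Z x)
    - β x (mlieBracket I X Y x) (Z x)
    - β x (mlieBracket I Y Z x) (X x)
    - β x (mlieBracket I Z X x) (Y x))

/-- The wedge product of a linear form and an alternating bilinear form. -/
noncomputable def wedgeOneTwo {V : Type*} (α : V → ℝ) (β : V → V → ℝ) (u v w : V) : ℝ :=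
  (1 / 3) * (α u * β v w + α v * β w u + α w * β u v)

/-- Up to a nonzero constant factor, `(η¹ ∧ ⋯ ∧ ηˢ ∧ βⁿ)(v₁, …, v_{s + 2n})`: the alternating sum of
`∏ᵢ ηⁱ(vᵢ) ∏ₖ β(v_{k,0}, v_{k,1})`, where the `s + 2n` arguments are indexed by
`Fin s ⊕ Fin n × Fin 2`. -/
noncomputable def topWedge {V : Type*} {s : ℕ} (n : ℕ) (η : Fin s → V → ℝ) (β : V → V → ℝ)
    (v : Fin s ⊕ Fin n × Fin 2 → V) : ℝ :=
  ∑ σ : Equiv.Perm (Fin s ⊕ Fin n × Fin 2), ((Equiv.Perm.sign σ : ℤ) : ℝ) *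
    ((∏ i : Fin s, η i (v (σ (Sum.inl i)))) *
      ∏ k : Fin n, β (v (σ (Sum.inr (k, 0)))) (v (σ (Sum.inr (k, 1)))))

/-- The Nijenhuis tensor
`[φ, φ](X, Y) = φ² [X, Y] + [φ X, φ Y] - φ [φ X, Y] - φ [X, φ Y]`. -/
noncomputable def nijenhuis (φ : Π x : M, TangentSpace I x →L[ℝ] TangentSpace I x)
    (X Y : Π x : M, TangentSpace I x) (x : M) : TangentSpace I x :=
  φ x (φ x (mlieBracket I X Y x))
    + mlieBracket I (fun y => φ y (X y)) (fun y => φ y (Y y)) x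
    - φ x (mlieBracket I (fun y => φ y (X y)) Y x)
    - φ x (mlieBracket I X (fun y => φ y (Y y)) x)

end ExteriorCalculus

section GeneralizedKenmotsu

variable {E : Type*} [NormedAddCommGroup E] [NormedSpace ℝ E]
  {H : Type*} [TopologicalSpace H] {I : ModelWithCorners ℝ E H}
  {M : Type*} [TopologicalSpace M] [ChartedSpace H M] [IsManifold I ∞ M]

/-- A metric `f`-structure `(φ, ξᵢ, ηⁱ)`, `1 ≤ i ≤ s`, on a Riemannian manifold. -/
structure MetricFStructure (g : RiemMetric I M) (s : ℕ) where
  /-- the tensor field of type (1,1) -/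
  φ : Π x : M, TangentSpace I x →L[ℝ] TangentSpace I x
  /-- the structure vector fields -/
  ξ : Fin s → Π x : M, TangentSpace I x
  /-- the structure 1-forms -/
  η : Fin s → Π x : M, TangentSpace I x →L[ℝ] ℝ
  smooth_φ : ContMDiff I (I.prod 𝓘(ℝ, E →L[ℝ] E)) ∞
    (fun x => (TotalSpace.mk' (E →L[ℝ] E) x (φ x) :
      TotalSpace (E →L[ℝ] E) (fun x : M => TangentSpace I x →L[ℝ] TangentSpace I x)))
  smooth_ξ : ∀ i, ContMDiff I (I.prod 𝓘(ℝ, E)) ∞ (fun x => TotalSpace.mk' E x (ξ i x))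
  smooth_η : ∀ i, ContMDiff I (I.prod 𝓘(ℝ, E →L[ℝ] ℝ)) ∞
    (fun x => (TotalSpace.mk' (E →L[ℝ] ℝ) x (η i x) :
      TotalSpace (E →L[ℝ] ℝ) (fun x : M => TangentSpace I x →L[ℝ] ℝ)))
  φ_sq : ∀ (x : M) (u : TangentSpace I x), φ x (φ x u) = -u + ∑ i, η i x u • ξ i x
  η_ξ : ∀ (x : M) (i j : Fin s), η i x (ξ j x) = if i = j then 1 else 0
  inner_φ : ∀ (x : M) (u v : TangentSpace I x),
    g.inner x (φ x u) (φ x v) = g.inner x u v - ∑ i, η i x u * η i x v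
  η_eq_inner : ∀ (x : M) (i : Fin s) (u : TangentSpace I x), η i x u = g.inner x u (ξ i x)
  φ_skew : ∀ (x : M) (u v : TangentSpace I x), g.inner x u (φ x v) = -g.inner x (φ x u) v
  φ_ξ : ∀ (x : M) (i : Fin s), φ x (ξ i x) = 0
  η_φ : ∀ (x : M) (i : Fin s) (u : TangentSpace I x), η i x (φ x u) = 0

namespace MetricFStructure

variable {g : RiemMetric I M} {s : ℕ}

/-- The fundamental 2-form `Φ(X, Y) = g(X, φ Y)`. -/
noncomputable def fundForm (S : MetricFStructure g s) (x : M) (u v : TangentSpace I x) : ℝ :=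
  g.inner x u (S.φ x v)

/-- Normality: `[φ, φ] + 2 ∑ dηⁱ ⊗ ξᵢ = 0`. -/
def IsNormal (S : MetricFStructure g s) : Prop :=
  ∀ (x : M) (X Y : Π x : M, TangentSpace I x), SmoothFieldAt I X x → SmoothFieldAt I Y x →
    nijenhuis I S.φ X Y x + (2 : ℝ) • ∑ i, extDerivOne I (S.η i) X Y x • S.ξ i x = 0

/-- Almost `s`-contact metric structure on a manifold of dimension `2n + s`:
`η¹ ∧ ⋯ ∧ ηˢ ∧ Φⁿ` vanishes nowhere. -/
def IsAlmostSContact (S : MetricFStructure g s) (n : ℕ) : Prop :=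
  Module.finrank ℝ E = 2 * n + s ∧
    ∀ x : M, ∃ v, topWedge n (fun i => S.η i x) (S.fundForm x) v ≠ 0

/-- Generalized almost Kenmotsu: the `ηⁱ` are closed and `dΦ = 2 ∑ ηⁱ ∧ Φ`. -/
structure IsGeneralizedAlmostKenmotsu (S : MetricFStructure g s) (n : ℕ) : Prop where
  almostSContact : S.IsAlmostSContact n
  closed_η : ∀ (i : Fin s) (x : M) (X Y : Π x : M, TangentSpace I x),
    SmoothFieldAt I X x → SmoothFieldAt I Y x → extDerivOne I (S.η i) X Y x = 0
  d_fundForm : ∀ (x : M) (X Y Z : Π x : M, TangentSpace I x),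
    SmoothFieldAt I X x → SmoothFieldAt I Y x → SmoothFieldAt I Z x →
      extDerivTwo I S.fundForm X Y Z x
        = 2 * ∑ i, wedgeOneTwo (S.η i x) (S.fundForm x) (X x) (Y x) (Z x)

/-- Generalized Kenmotsu: normal and generalized almost Kenmotsu. -/
structure IsGeneralizedKenmotsu (S : MetricFStructure g s) (n : ℕ) : Prop
    extends S.IsGeneralizedAlmostKenmotsu n where
  normal : S.IsNormal

end MetricFStructure

end GeneralizedKenmotsu

section Submanifold

variable {E : Type*} [NormedAddCommGroup E] [NormedSpace ℝ E]
  {H : Type*} [TopologicalSpace H] {I : ModelWithCorners ℝ E H}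
  {M : Type*} [TopologicalSpace M] [ChartedSpace H M] [IsManifold I ∞ M]
  {E' : Type*} [NormedAddCommGroup E'] [NormedSpace ℝ E']
  {H' : Type*} [TopologicalSpace H'] {J : ModelWithCorners ℝ E' H'}
  {N : Type*} [TopologicalSpace N] [ChartedSpace H' N] [IsManifold J ∞ N]

/-- `f` makes `(M, g)` an (immersed) submanifold of `(N, gN)` with its induced metric. The
differential of `f` is injective because it preserves the scalar products. -/
structure IsIsometricImmersion (g : RiemMetric I M) (gN : RiemMetric J N) (f : M → N) : Prop where
  smooth : ContMDiff I J ∞ f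
  inner_mfderiv : ∀ (p : M) (u v : TangentSpace I p),
    gN.inner (f p) (mfderiv I J f p u) (mfderiv I J f p v) = g.inner p u v

variable (I) in
/-- The covariant derivative along `f` of a field `V` of tangent vectors of `N` along `f`, for a
connection `D` of `N`. If `(eᵢ)` is the frame near `f p` given by the trivialization of the tangent
bundle at `f p`, and `V = ∑ Vⁱ eᵢ`, it is `∑ u(Vⁱ) eᵢ + ∑ Vⁱ D_{df u} eᵢ`; the second sum is the
derivative of the extension of `V p` with constant coefficients. -/
noncomputable def covAlong (D : CovariantDerivative J E' (fun y : N => TangentSpace J y))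
    (f : M → N) (V : Π p : M, TangentSpace J (f p)) (p : M) (u : TangentSpace I p) :
    TangentSpace J (f p) :=
  (trivializationAt E' (fun y : N => TangentSpace J y) (f p)).symm (f p)
      (mvfderiv I (fun q => (trivializationAt E' (fun y : N => TangentSpace J y) (f p)
        ⟨f q, V q⟩).2) p u)
    + D (FiberBundle.extend E' (V p)) (f p) (mfderiv I J f p u)

variable [FiniteDimensional ℝ E] [FiniteDimensional ℝ E']

/-- The second fundamental form, by the Gauss formula: `h(X, Y) = ∇̄_X Y - ∇_X Y`, where vectors of
`M` are identified with their images under `df`. -/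
noncomputable def secondFundForm (g : RiemMetric I M) (gN : RiemMetric J N) (f : M → N)
    (X Y : Π p : M, TangentSpace I p) (p : M) : TangentSpace J (f p) :=
  covAlong I gN.leviCivita f (fun q => mfderiv I J f q (Y q)) p (X p)
    - mfderiv I J f p (g.leviCivita Y p (X p))

namespace MetricFStructure

variable {gN : RiemMetric J N} {s : ℕ}

variable (I) in
/-- Invariant submanifold: `φ` preserves the tangent spaces, and all `ξᵢ` are tangent. -/
structure IsInvariant (S : MetricFStructure gN s) (f : M → N) : Prop where
  φ_tangent : ∀ (p : M) (u : TangentSpace I p),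
    ∃ v : TangentSpace I p, mfderiv I J f p v = S.φ (f p) (mfderiv I J f p u)
  ξ_tangent : ∀ (i : Fin s) (p : M), ∃ v : TangentSpace I p, mfderiv I J f p v = S.ξ i (f p)

/-- The restriction of `φ` to the tangent spaces of an invariant submanifold; as `df` is injective,
`φ_tangent` determines it. -/
noncomputable def IsInvariant.φ {S : MetricFStructure gN s} {f : M → N} (h : S.IsInvariant I f)
    (p : M) (u : TangentSpace I p) : TangentSpace I p :=
  (h.φ_tangent p u).choose

/-- The field `ξᵢ` as a vector field on an invariant submanifold; as `df` is injective,
`ξ_tangent` determines it. -/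
noncomputable def IsInvariant.ξ {S : MetricFStructure gN s} {f : M → N} (h : S.IsInvariant I f)
    (i : Fin s) (p : M) : TangentSpace I p :=
  (h.ξ_tangent i p).choose

end MetricFStructure

end Submanifold

/-! ### Lie brackets acting on vector-valued functions -/

section LieBracketDerivation

variable {E : Type*} [NormedAddCommGroup E] [NormedSpace ℝ E]
  {H : Type*} [TopologicalSpace H] {I : ModelWithCorners ℝ E H}
  {M : Type*} [TopologicalSpace M] [ChartedSpace H M] [IsManifold I ∞ M]
  {E' : Type*} [NormedAddCommGroup E'] [NormedSpace ℝ E']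
  {H' : Type*} [TopologicalSpace H'] {J : ModelWithCorners ℝ E' H'}
  {N : Type*} [TopologicalSpace N] [ChartedSpace H' N] [IsManifold J ∞ N]

/-! On the ambient manifold, Koszul's formula together with `dηʲ = 0` gives `2 g(∇_Y ξⱼ, Z) =
(L_{ξⱼ} g)(Y, Z)`, so it suffices to compute the Lie derivative of the metric. Closedness of the
`ηⁱ` and normality, evaluated on `ξⱼ`, give `[ξᵢ, ξⱼ] = 0` and `L_{ξⱼ} φ = 0`; inserting `ξⱼ` in the
equation for `dΦ` gives `L_{ξⱼ} Φ = 2Φ`. Hence `L_{ξⱼ} g` is `2g` when one argument is in the image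
of `φ`, and `0` when one argument is some `ξᵢ`. These vectors span the tangent space, and `∇_u ξⱼ =
-φ² u` follows (`IsGeneralizedKenmotsu.leviCivita_ξ`).

Along an invariant submanifold `f`, the derivative of `ξⱼ ∘ f` in the direction `df X` is therefore
`-φ² (df X)`, which is again tangent. The tangential part of the ambient derivative is the induced
Levi-Civita derivative (`IsIsometricImmersion.inner_covAlong`), so `∇_X ξⱼ = -φ² X` and nothing
remains for `h(X, ξⱼ)`. Symmetry of `h` gives the last equation.

The remaining work is the calculus of `covAlong`: it agrees with the connection on restrictions of
ambient fields (`covAlong_comp`), is metric (`mvfderiv_inner_covAlong`) and has no torsion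
(`covAlong_mfderiv_sub`). The last property rests on `[X, Y] F = X (Y F) - Y (X F)`
(`mvfderiv_mlieBracket`). -/

theorem mdifferentiableAt_mfderiv_apply {f : M → N} {p : M} (hf : ContMDiffAt I J ∞ f p)
    {Y : Π x : M, TangentSpace I x} (hY : MDiffAt (T% Y) p) :
    MDifferentiableAt I (J.prod 𝓘(ℝ, E'))
      (fun q => (TotalSpace.mk' E' (f q) (mfderiv I J f q (Y q)) : TangentBundle J N)) p := by
  have h := (hf.mfderiv_const (m := 1) (by decide)).mdifferentiableAt one_ne_zero
  exact MDifferentiableAt.clm_apply_of_inCoordinates (b₁ := id) (b₂ := f)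
    (ϕ := fun q => mfderiv I J f q) (E₁ := fun x : M => TangentSpace I x)
    (E₂ := fun x : N => TangentSpace J x) h hY (hf.mdifferentiableAt (by simp))

theorem mdifferentiableAt_mvfderiv_apply {F : M → E'} {p : M} (hF : ContMDiffAt I 𝓘(ℝ, E') ∞ F p)
    {Y : Π x : M, TangentSpace I x} (hY : MDiffAt (T% Y) p) :
    MDifferentiableAt I 𝓘(ℝ, E') (fun q => mvfderiv I F q (Y q)) p := by
  have h := mdifferentiableAt_mfderiv_apply hF hY
  rw [mdifferentiableAt_totalSpace] at h
  simpa using! h.2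

/-- Chain rule: the pullback of `Y` inverts the derivative of the inverse chart, and differentiating
`F ∘ (extChartAt I x).symm` applies that same derivative, so the two cancel. -/
theorem mvfderiv_mpullbackWithin_extChartAt_symm {F : M → E'} {x : M} {z : E}
    (hz : z ∈ (extChartAt I x).target)
    (hF : MDifferentiableAt I 𝓘(ℝ, E') F ((extChartAt I x).symm z))
    (Y : Π x : M, TangentSpace I x) :
    fderivWithin ℝ (F ∘ (extChartAt I x).symm) (Set.range I) z
        (mpullbackWithin 𝓘(ℝ, E) I (extChartAt I x).symm Y (Set.range I) z)
      = mvfderiv I F ((extChartAt I x).symm z) (Y ((extChartAt I x).symm z)) := by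
  have hzr := extChartAt_target_subset_range x hz
  have h1 := mfderiv_comp_mfderivWithin (x := z) hF
    (mdifferentiableWithinAt_extChartAt_symm hz) (I.uniqueMDiffOn z hzr)
  rw [mfderivWithin_eq_fderivWithin] at h1
  have h2 := (isInvertible_mfderivWithin_extChartAt_symm (I := I) hz).self_apply_inverse
    (Y ((extChartAt I x).symm z))
  rw [mpullbackWithin_apply]
  conv_rhs => rw [← h2]
  exact congr($h1 _)

/-- In a chart this is the symmetry of the second derivative of `F`; the rest of the proof
transports derivatives and fields between the manifold and the chart. -/
theorem mvfderiv_mlieBracket [CompleteSpace E] {F : M → E'} {x : M}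
    (hF : ContMDiffAt I 𝓘(ℝ, E') ∞ F x) {X Y : Π x : M, TangentSpace I x}
    (hX : MDiffAt (T% X) x) (hY : MDiffAt (T% Y) x) :
    mvfderiv I F x (mlieBracket I X Y x)
      = mvfderiv I (fun y => mvfderiv I F y (Y y)) x (X x)
        - mvfderiv I (fun y => mvfderiv I F y (X y)) x (Y x) := by
  set φ := extChartAt I x with hφ
  have hz : φ x ∈ φ.target := mem_extChartAt_target x
  have hxz : φ.symm (φ x) = x := extChartAt_to_inv x
  have key : ∀ {Z : Π x : M, TangentSpace I x},
      (fun z => fderivWithin ℝ (F ∘ φ.symm) (Set.range I) z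
        (mpullbackWithin 𝓘(ℝ, E) I φ.symm Z (Set.range I) z)) =ᶠ[𝓝[Set.range I] (φ x)]
      (fun y => mvfderiv I F y (Z y)) ∘ φ.symm := by
    intro Z
    have h1 : ∀ᶠ y in 𝓝 x, MDifferentiableAt I 𝓘(ℝ, E') F y :=
      (contMDiffAt_iff_contMDiffAt_nhds (by simp)).1 (hF.of_le (m := 1) (by decide)) |>.mono
        fun y hy => hy.mdifferentiableAt one_ne_zero
    have h2 : ContinuousWithinAt φ.symm (Set.range I) (φ x) :=
      (continuousAt_extChartAt_symm x).continuousWithinAt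
    rw [ContinuousWithinAt, hxz] at h2
    filter_upwards [h2.eventually h1, extChartAt_target_mem_nhdsWithin x] with z hz1 hz2
    exact mvfderiv_mpullbackWithin_extChartAt_symm hz2 hz1 Z
  have h3 : ∀ {G : M → E'} {Z : Π x : M, TangentSpace I x}, MDifferentiableAt I 𝓘(ℝ, E') G x →
      fderivWithin ℝ (G ∘ φ.symm) (Set.range I) (φ x)
        (mpullbackWithin 𝓘(ℝ, E) I φ.symm Z (Set.range I) (φ x)) = mvfderiv I G x (Z x) := by
    intro G Z hG
    rw [← hxz] at hG
    have := mvfderiv_mpullbackWithin_extChartAt_symm hz hG Z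
    rwa [← hφ, hxz] at this
  have hd : ∀ {Z : Π x : M, TangentSpace I x}, MDiffAt (T% Z) x →
      DifferentiableWithinAt ℝ (mpullbackWithin 𝓘(ℝ, E) I φ.symm Z (Set.range I))
        (Set.range I) (φ x) := by
    intro Z hZ
    have := MDifferentiableWithinAt.differentiableWithinAt_mpullbackWithin_vectorField
      (mdifferentiableWithinAt_univ.2 hZ)
    rwa [Set.preimage_univ, Set.univ_inter] at this
  have hc : ContDiffWithinAt ℝ ∞ (F ∘ φ.symm) (Set.range I) (φ x) := by
    have := (contMDiffAt_iff.1 hF).2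
    simpa only [extChartAt_model_space_eq_id, PartialEquiv.refl_coe, Function.id_comp] using this
  have h4 := fderivWithin_apply_lieBracket hc (by rw [minSmoothness_of_isRCLikeNormedField]; decide) I.uniqueDiffOn
    (I.range_subset_closure_interior (Set.mem_range_self _)) (Set.mem_range_self _)
    (hd hY) (hd hX)
  rw [key.fderivWithin_eq_of_mem (Set.mem_range_self _),
    key.fderivWithin_eq_of_mem (Set.mem_range_self _),
    h3 (mdifferentiableAt_mvfderiv_apply hF hY), h3 (mdifferentiableAt_mvfderiv_apply hF hX)] at h4
  rw [← h4, ← mlieBracketWithin_univ, mlieBracketWithin_apply, Set.preimage_univ, Set.univ_inter]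
  set L := lieBracketWithin ℝ (mpullbackWithin 𝓘(ℝ, E) I φ.symm X (Set.range I))
    (mpullbackWithin 𝓘(ℝ, E) I φ.symm Y (Set.range I)) (Set.range I) (φ x)
  -- The bracket on the manifold is the chart bracket `L` pulled back at the single point `x`.
  -- Extending its value to a field `Z` makes `h3` applicable to it; only the value at `x` matters.
  let Z : Π y : M, TangentSpace I y := fun y => (mfderiv I 𝓘(ℝ, E) φ y).inverse L
  have h5 : mpullbackWithin 𝓘(ℝ, E) I φ.symm Z (Set.range I) (φ x)
      = mfderiv I 𝓘(ℝ, E) φ (φ.symm (φ x)) (Z (φ.symm (φ x))) := by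
    rw [← (isInvertible_mfderivWithin_extChartAt_symm (I := I) hz).self_apply_inverse
      (Z (φ.symm (φ x)))]
    exact (congr($(mfderiv_extChartAt_comp_mfderivWithin_extChartAt_symm (I := I) hz) _)).symm
  rw [hxz] at h5
  rw [← h3 (Z := Z) (hF.mdifferentiableAt (by simp)), h5]
  congr 1
  exact (isInvertible_mfderiv_extChartAt (I := I) (mem_extChartAt_source x)).self_apply_inverse L

end LieBracketDerivation

/-! ### Product and chain rules for vector-valued functions -/

section VectorValued

variable {E : Type*} [NormedAddCommGroup E] [NormedSpace ℝ E]
  {H : Type*} [TopologicalSpace H] {I : ModelWithCorners ℝ E H}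
  {M : Type*} [TopologicalSpace M] [ChartedSpace H M]
  {F : Type*} [NormedAddCommGroup F] [NormedSpace ℝ F]
  {F' : Type*} [NormedAddCommGroup F'] [NormedSpace ℝ F']
  {F'' : Type*} [NormedAddCommGroup F''] [NormedSpace ℝ F'']

theorem mvfderiv_congr_of_eventuallyEq {a b : M → F} {p : M} (h : a =ᶠ[𝓝 p] b)
    (u : TangentSpace I p) : mvfderiv I a p u = mvfderiv I b p u := by
  have := h.mfderiv_eq (I := I) (I' := 𝓘(ℝ, F))
  exact congr($this u)

theorem mvfderiv_clm_apply {A : M → F →L[ℝ] F'} {a : M → F} {p : M}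
    (hA : MDifferentiableAt I 𝓘(ℝ, F →L[ℝ] F') A p) (ha : MDifferentiableAt I 𝓘(ℝ, F) a p)
    (u : TangentSpace I p) :
    mvfderiv I (fun q => A q (a q)) p u = mvfderiv I A p u (a p) + A p (mvfderiv I a p u) := by
  rw [(hA.clm_apply ha).mvfderiv, hA.mvfderiv, ha.mvfderiv]
  have hA' := hA.differentiableWithinAt_writtenInExtChartAt
  have ha' := ha.differentiableWithinAt_writtenInExtChartAt
  have := fderivWithin_clm_apply
    (I.uniqueDiffOn _ (Set.mem_range_self (chartAt H p p))) hA' ha'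
  have h2 := congr($this u)
  simpa [writtenInExtChartAt, add_comm] using! h2

theorem mvfderiv_clm_apply₂ {A : M → F →L[ℝ] F' →L[ℝ] F''} {a : M → F} {b : M → F'} {p : M}
    (hA : MDifferentiableAt I 𝓘(ℝ, F →L[ℝ] F' →L[ℝ] F'') A p)
    (ha : MDifferentiableAt I 𝓘(ℝ, F) a p) (hb : MDifferentiableAt I 𝓘(ℝ, F') b p)
    (u : TangentSpace I p) :
    mvfderiv I (fun q => A q (a q) (b q)) p u = mvfderiv I A p u (a p) (b p)
      + A p (mvfderiv I a p u) (b p) + A p (a p) (mvfderiv I b p u) := by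
  rw [mvfderiv_clm_apply (hA.clm_apply ha) hb, mvfderiv_clm_apply hA ha]
  simp

theorem mvfderiv_comp_mfderiv
    {E' : Type*} [NormedAddCommGroup E'] [NormedSpace ℝ E']
    {H' : Type*} [TopologicalSpace H'] {J : ModelWithCorners ℝ E' H'}
    {N : Type*} [TopologicalSpace N] [ChartedSpace H' N] {f : M → N} {A : N → F} {p : M}
    (hA : MDifferentiableAt J 𝓘(ℝ, F) A (f p)) (hf : MDifferentiableAt I J f p)
    (u : TangentSpace I p) :
    mvfderiv I (fun q => A (f q)) p u = mvfderiv J A (f p) (mfderiv I J f p u) :=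
  mfderiv_comp_apply p hA hf u

end VectorValued

/-! ### The tangent bundle in chart coordinates -/

section Trivialization

variable {E' : Type*} [NormedAddCommGroup E'] [NormedSpace ℝ E']
  {H' : Type*} [TopologicalSpace H'] {J : ModelWithCorners ℝ E' H'}
  {N : Type*} [TopologicalSpace N] [ChartedSpace H' N] [IsManifold J ∞ N]

theorem trivializationAt_tangentSpace_snd {y₀ y : N} (hy : y ∈ (chartAt H' y₀).source)
    (v : TangentSpace J y) :
    (trivializationAt E' (fun y : N => TangentSpace J y) y₀ ⟨y, v⟩).2
      = mvfderiv J (extChartAt J y₀) y v := by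
  have h := TangentBundle.continuousLinearMapAt_trivializationAt (I := J) hy
  rw [← Trivialization.continuousLinearMapAt_apply_of_mem (R := ℝ) _ (by simpa using hy)]
  exact congr($h v)

theorem extend_trivializationAt_snd {y₀ y : N} (hy : y ∈ (chartAt H' y₀).source)
    (v : TangentSpace J y₀) :
    (trivializationAt E' (fun y : N => TangentSpace J y) y₀ ⟨y, FiberBundle.extend E' v y⟩).2
      = (trivializationAt E' (fun y : N => TangentSpace J y) y₀ ⟨y₀, v⟩).2 := by
  rw [FiberBundle.extend, Trivialization.apply_mk_symm _ (by simpa using hy)]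

/-- Both fields have constant components in the chart at `y₀`. Applying the bracket formula to the
chart map itself kills the bracket, since the differential of the chart is injective. -/
theorem mlieBracket_extend [CompleteSpace E'] {y₀ : N} (v w : TangentSpace J y₀) :
    mlieBracket J (FiberBundle.extend E' v) (FiberBundle.extend E' w) y₀ = 0 := by
  have hc : ∀ v : TangentSpace J y₀,
      (fun y => mvfderiv J (extChartAt J y₀) y (FiberBundle.extend E' v y)) =ᶠ[𝓝 y₀]
      fun _ => (trivializationAt E' (fun y : N => TangentSpace J y) y₀ ⟨y₀, v⟩).2 := by
    intro v
    filter_upwards [chart_source_mem_nhds H' y₀] with y hy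
    rw [← trivializationAt_tangentSpace_snd hy, extend_trivializationAt_snd hy]
  have h := mvfderiv_mlieBracket (F := extChartAt J y₀) (x := y₀)
    (contMDiffAt_extChartAt (I := J) (n := ∞))
    (FiberBundle.mdifferentiableAt_extend J E' v) (FiberBundle.mdifferentiableAt_extend J E' w)
  rw [mvfderiv_congr_of_eventuallyEq (hc v), mvfderiv_congr_of_eventuallyEq (hc w),
    mvfderiv_const, mvfderiv_const] at h
  exact (isInvertible_mfderiv_extChartAt (mem_extChartAt_source y₀)).injective
    (h.trans ((sub_self (0 : E')).trans (map_zero (mvfderiv J (extChartAt J y₀) y₀)).symm))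

end Trivialization

/-! ### The covariant derivative along a map -/

section CovAlong

variable {E : Type*} [NormedAddCommGroup E] [NormedSpace ℝ E]
  {H : Type*} [TopologicalSpace H] {I : ModelWithCorners ℝ E H}
  {M : Type*} [TopologicalSpace M] [ChartedSpace H M]
  {E' : Type*} [NormedAddCommGroup E'] [NormedSpace ℝ E']
  {H' : Type*} [TopologicalSpace H'] {J : ModelWithCorners ℝ E' H'}
  {N : Type*} [TopologicalSpace N] [ChartedSpace H' N] [IsManifold J ∞ N]
  [FiniteDimensional ℝ E']

theorem covAlong_comp (D : CovariantDerivative J E' (fun y : N => TangentSpace J y))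
    {f : M → N} {p : M} (hf : MDifferentiableAt I J f p) {W : Π y : N, TangentSpace J y}
    (hW : MDiffAt (T% W) (f p)) (u : TangentSpace I p) :
    covAlong I D f (fun q => W (f q)) p u = D W (f p) (mfderiv I J f p u) := by
  set e := trivializationAt E' (fun y : N => TangentSpace J y) (f p) with he
  have hb : f p ∈ e.baseSet := FiberBundle.mem_baseSet_trivializationAt' (f p)
  have hbn : e.baseSet ∈ 𝓝 (f p) := e.open_baseSet.mem_nhds hb
  set w := mfderiv I J f p u
  have hd : ∀ {Z : Π y : N, TangentSpace J y}, MDiffAt (T% Z) (f p) →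
      MDifferentiableAt J 𝓘(ℝ, E') (fun y => (e ⟨y, Z y⟩).2) (f p) := fun hZ =>
    (mdifferentiableAt_section _ _).1 hZ
  -- The connection minus the flat derivative of the components is tensorial, as the Leibniz terms
  -- cancel. It may thus be evaluated on the extension of `W (f p)` with constant components, whose
  -- flat derivative is zero.
  have hT : TensorialAt J E' (fun Z : Π y : N, TangentSpace J y =>
      D Z (f p) w - e.symm (f p) (mvfderiv J (fun y => (e ⟨y, Z y⟩).2) (f p) w)) (f p) := by
    constructor
    · intro a Z ha hZ
      have h1 : (fun y => (e ⟨y, (a • Z) y⟩).2) =ᶠ[𝓝 (f p)] fun y => a y • (e ⟨y, Z y⟩).2 := by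
        filter_upwards [hbn] with y hy
        exact (e.linear ℝ hy).map_smul (a y) (Z y)
      rw [mvfderiv_congr_of_eventuallyEq h1]
      have h2 := mvfderiv_smul ha (hd hZ)
      have h3 := congr($h2 w)
      rw [D.isCovariantDerivativeOnUniv.leibniz hZ ha]
      have h5 : (mvfderiv J (fun y => a y • (e ⟨y, Z y⟩).2) (f p) w : E')
          = a (f p) • mvfderiv J (fun y => (e ⟨y, Z y⟩).2) (f p) w
            + mvfderiv J a (f p) w • (e ⟨f p, Z (f p)⟩).2 := by
        simpa using! h3
      rw [h5, ← Trivialization.symmL_apply (R := ℝ) _ hb, ← Trivialization.symmL_apply (R := ℝ) _ hb,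
        map_add, map_smul, map_smul, Trivialization.symmL_apply (R := ℝ) _ hb (e ⟨f p, Z (f p)⟩).2,
        Trivialization.symm_apply_apply_mk _ hb]
      simp only [add_apply, smul_apply, ContinuousLinearMap.smulRight_apply, smul_sub]
      abel
    · intro Z Z' hZ hZ'
      have h1 : (fun y => (e ⟨y, (Z + Z') y⟩).2) =ᶠ[𝓝 (f p)]
          (fun y => (e ⟨y, Z y⟩).2) + fun y => (e ⟨y, Z' y⟩).2 := by
        filter_upwards [hbn] with y hy
        exact (e.linear ℝ hy).map_add (Z y) (Z' y)
      rw [mvfderiv_congr_of_eventuallyEq h1, mvfderiv_add (hd hZ) (hd hZ'),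
        D.isCovariantDerivativeOnUniv.add hZ hZ', ← Trivialization.symmL_apply (R := ℝ) _ hb,
        ← Trivialization.symmL_apply (R := ℝ) _ hb, ← Trivialization.symmL_apply (R := ℝ) _ hb]
      simp only [add_apply, map_add]
      abel
  have h0 := hT.pointwise hW (FiberBundle.mdifferentiableAt_extend J E' (W (f p))) (by simp)
  have h4 : (fun y => (e ⟨y, FiberBundle.extend E' (W (f p)) y⟩).2) =ᶠ[𝓝 (f p)]
      fun _ => (e ⟨f p, W (f p)⟩).2 := by
    filter_upwards [hbn] with y hy
    exact extend_trivializationAt_snd hy _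
  simp only [mvfderiv_congr_of_eventuallyEq h4] at h0
  rw [covAlong, ← he, mvfderiv_comp_mfderiv (hd hW) hf]
  rw [mvfderiv_const] at h0
  have h6 : e.symm (f p) ((0 : TangentSpace J (f p) →L[ℝ] E') w) = 0 := by
    rw [← Trivialization.symmL_apply (R := ℝ) _ hb, zero_apply, map_zero]
  rw [h6, sub_zero] at h0
  rw [← h0]
  abel

/-- In the trivialization the scalar product is a function `G` with values in bilinear forms, and
the product rule gives three terms. The derivatives of the components match the flat parts of
`covAlong`; the derivative of `G` is found from metric compatibility on fields with constant
components. -/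
theorem mvfderiv_inner_covAlong (g : RiemMetric J N) {f : M → N} {p : M}
    {V W : Π q : M, TangentSpace J (f q)}
    (hV : MDifferentiableAt I (J.prod 𝓘(ℝ, E'))
      (fun q => (TotalSpace.mk' E' (f q) (V q) : TangentBundle J N)) p)
    (hW : MDifferentiableAt I (J.prod 𝓘(ℝ, E'))
      (fun q => (TotalSpace.mk' E' (f q) (W q) : TangentBundle J N)) p) (u : TangentSpace I p) :
    mvfderiv I (fun q => g.inner (f q) (V q) (W q)) p u
      = g.inner (f p) (covAlong I g.leviCivita f V p u) (W p)
        + g.inner (f p) (V p) (covAlong I g.leviCivita f W p u) := by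
  rw [mdifferentiableAt_totalSpace] at hV hW
  have hf : MDifferentiableAt I J f p := hV.1
  have hv := hV.2
  have hw := hW.2
  dsimp only at hv hw
  set e := trivializationAt E' (fun y : N => TangentSpace J y) (f p) with he
  have hb : f p ∈ e.baseSet := FiberBundle.mem_baseSet_trivializationAt' (f p)
  have hbn : e.baseSet ∈ 𝓝 (f p) := e.open_baseSet.mem_nhds hb
  let G : N → E' →L[ℝ] E' →L[ℝ] ℝ := fun y => (trivializationAt (E' →L[ℝ] E' →L[ℝ] ℝ)
    (fun y : N => TangentSpace J y →L[ℝ] TangentSpace J y →L[ℝ] ℝ) (f p) ⟨y, g.inner y⟩).2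
  have hG : MDifferentiableAt J 𝓘(ℝ, E' →L[ℝ] E' →L[ℝ] ℝ) G (f p) :=
    (mdifferentiableAt_section _ _).1 (g.contMDiff.mdifferentiableAt (by simp))
  have hGa : ∀ y ∈ e.baseSet, ∀ a b : TangentSpace J y,
      G y (e ⟨y, a⟩).2 (e ⟨y, b⟩).2 = g.inner y a b := by
    intro y hy a b
    have h1 : (trivializationAt E' (TangentSpace J) (f p)).symmL ℝ y
        (e.continuousLinearMapAt ℝ y a) = a := e.symmL_continuousLinearMapAt (R := ℝ) hy a
    have h2 : (trivializationAt E' (TangentSpace J) (f p)).symmL ℝ y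
        (e.continuousLinearMapAt ℝ y b) = b := e.symmL_continuousLinearMapAt (R := ℝ) hy b
    rw [Trivialization.continuousLinearMapAt_apply_of_mem (R := ℝ) _ hy] at h1 h2
    have hy2 : y ∈ (trivializationAt (E' →L[ℝ] ℝ)
        (fun y : N => TangentSpace J y →L[ℝ] ℝ) (f p)).baseSet := by
      rw [hom_trivializationAt_baseSet]
      exact ⟨hy, trivial⟩
    simp only [G, hom_trivializationAt_apply, ContinuousLinearMap.inCoordinates,
      ContinuousLinearMap.comp_apply]
    rw [h1, Trivialization.continuousLinearMapAt_apply_of_mem (R := ℝ) _ hy2]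
    simp only [hom_trivializationAt_apply, ContinuousLinearMap.inCoordinates,
      ContinuousLinearMap.comp_apply]
    rw [h2]
    simp
  set u' := mfderiv I J f p u with hu'
  have hcomp : (fun q => g.inner (f q) (V q) (W q)) =ᶠ[𝓝 p]
      fun q => G (f q) (e ⟨f q, V q⟩).2 (e ⟨f q, W q⟩).2 := by
    filter_upwards [hf.continuousAt.eventually hbn] with q hq
    rw [hGa _ hq]
  rw [mvfderiv_congr_of_eventuallyEq hcomp,
    mvfderiv_clm_apply₂ (A := fun q => G (f q)) (hG.comp p hf) hv hw, mvfderiv_comp_mfderiv hG hf]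
  have hV' := FiberBundle.mdifferentiableAt_extend J E' (V p)
  have hW' := FiberBundle.mdifferentiableAt_extend J E' (W p)
  have hmet := g.leviCivita_metric (FiberBundle.mdifferentiableAt_extend J E' u') hV' hW'
  have hcomp' : (fun y => g.inner y (FiberBundle.extend E' (V p) y) (FiberBundle.extend E' (W p) y))
      =ᶠ[𝓝 (f p)] fun y => G y (e ⟨f p, V p⟩).2 (e ⟨f p, W p⟩).2 := by
    filter_upwards [hbn] with y hy
    rw [← hGa y hy, extend_trivializationAt_snd hy, extend_trivializationAt_snd hy]
  rw [mvfderiv_congr_of_eventuallyEq hcomp',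
    mvfderiv_clm_apply₂ hG mdifferentiableAt_const mdifferentiableAt_const] at hmet
  simp only [mvfderiv_const, zero_apply, map_zero, add_zero, FiberBundle.extend_apply_self] at hmet
  rw [hmet]
  have hs : ∀ a : E', (e ⟨f p, e.symm (f p) a⟩).2 = a := fun a => by
    rw [Trivialization.apply_mk_symm _ hb]
  simp only [covAlong, ← he, map_add, add_apply]
  rw [← hGa _ hb (e.symm (f p) _), ← hGa _ hb _ (e.symm (f p) _), hs, hs]
  ring

variable [IsManifold I ∞ M] [FiniteDimensional ℝ E]

/-- The connection terms cancel, because constant-component extensions commute and `D` has no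
torsion. The components of `df Y` are the derivatives along `Y` of the chart expression of `f`, so
the flat terms leave its derivative along `[X, Y]`. -/
theorem covAlong_mfderiv_sub (D : CovariantDerivative J E' (fun y : N => TangentSpace J y))
    (hD : D.torsion = 0) {f : M → N} {p : M} (hf : ContMDiffAt I J ∞ f p)
    {X Y : Π x : M, TangentSpace I x} (hX : MDiffAt (T% X) p) (hY : MDiffAt (T% Y) p) :
    covAlong I D f (fun q => mfderiv I J f q (Y q)) p (X p)
      - covAlong I D f (fun q => mfderiv I J f q (X q)) p (Y p)
      = mfderiv I J f p (mlieBracket I X Y p) := by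
  have := FiniteDimensional.complete ℝ E
  have := FiniteDimensional.complete ℝ E'
  have hF : ContMDiffAt I 𝓘(ℝ, E') ∞ (fun q => extChartAt J (f p) (f q)) p :=
    (contMDiffAt_extChartAt (I := J) (n := ∞) (x := f p)).comp p hf
  have hc : ∀ᶠ q in 𝓝 p, ∀ u : TangentSpace I q,
      (trivializationAt E' (fun y : N => TangentSpace J y) (f p) ⟨f q, mfderiv I J f q u⟩).2
      = mvfderiv I (fun q => extChartAt J (f p) (f q)) q u := by
    filter_upwards [hf.continuousAt.eventually (chart_source_mem_nhds H' (f p)),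
      (contMDiffAt_iff_contMDiffAt_nhds (by simp)).1 (hf.of_le (m := 1) (by decide))] with q hq hfq u
    rw [trivializationAt_tangentSpace_snd hq]
    exact (mvfderiv_comp_mfderiv (mdifferentiableAt_extChartAt hq)
      (hfq.mdifferentiableAt one_ne_zero) u).symm
  have hcZ : ∀ Z : Π x : M, TangentSpace I x,
      (fun q => (trivializationAt E' (fun y : N => TangentSpace J y) (f p)
        ⟨f q, mfderiv I J f q (Z q)⟩).2) =ᶠ[𝓝 p]
      fun q => mvfderiv I (fun q => extChartAt J (f p) (f q)) q (Z q) :=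
    fun Z => hc.mono fun q hq => hq (Z q)
  have hT := (CovariantDerivative.torsion_eq_zero_iff (cov := D)).1 hD
    (FiberBundle.mdifferentiableAt_extend J E' (mfderiv I J f p (X p)))
    (FiberBundle.mdifferentiableAt_extend J E' (mfderiv I J f p (Y p)))
  rw [mlieBracket_extend, FiberBundle.extend_apply_self, FiberBundle.extend_apply_self,
    sub_eq_zero] at hT
  simp only [covAlong]
  rw [hT, add_sub_add_right_eq_sub, mvfderiv_congr_of_eventuallyEq (hcZ X),
    mvfderiv_congr_of_eventuallyEq (hcZ Y)]
  have hb : f p ∈ (trivializationAt E' (fun y : N => TangentSpace J y) (f p)).baseSet :=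
    FiberBundle.mem_baseSet_trivializationAt' (f p)
  rw [← Trivialization.symmL_apply (R := ℝ) _ hb, ← Trivialization.symmL_apply (R := ℝ) _ hb,
    ← map_sub, ← mvfderiv_mlieBracket hF hX hY, ← hc.self_of_nhds,
    Trivialization.symmL_apply (R := ℝ) _ hb, Trivialization.symm_apply_apply_mk _ hb]

end CovAlong

/-! ### Tangential part and symmetry in the Gauss formula -/

section Gauss

variable {E : Type*} [NormedAddCommGroup E] [NormedSpace ℝ E]
  {H : Type*} [TopologicalSpace H] {I : ModelWithCorners ℝ E H}
  {M : Type*} [TopologicalSpace M] [ChartedSpace H M] [IsManifold I ∞ M]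
  {E' : Type*} [NormedAddCommGroup E'] [NormedSpace ℝ E']
  {H' : Type*} [TopologicalSpace H'] {J : ModelWithCorners ℝ E' H'}
  {N : Type*} [TopologicalSpace N] [ChartedSpace H' N] [IsManifold J ∞ N]

theorem IsIsometricImmersion.mfderiv_injective {g : RiemMetric I M} {gN : RiemMetric J N}
    {f : M → N} (hf : IsIsometricImmersion g gN f) (p : M) :
    Function.Injective (mfderiv I J f p) := by
  intro u v h
  refine g.ext_inner fun z => ?_
  rw [← hf.inner_mfderiv, ← hf.inner_mfderiv, h]

variable [FiniteDimensional ℝ E] [FiniteDimensional ℝ E']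

/-- The uniqueness argument for the Levi-Civita connection: `covAlong` is metric and torsion-free on
tangent fields, so its scalar products with tangent vectors satisfy Koszul's formula for `g`. -/
theorem IsIsometricImmersion.inner_covAlong {g : RiemMetric I M} {gN : RiemMetric J N} {f : M → N}
    (hf : IsIsometricImmersion g gN f) {X Y Z : Π p : M, TangentSpace I p} {p : M}
    (hX : MDiffAt (T% X) p) (hY : MDiffAt (T% Y) p) (hZ : MDiffAt (T% Z) p) :
    gN.inner (f p) (covAlong I gN.leviCivita f (fun q => mfderiv I J f q (Y q)) p (X p))
        (mfderiv I J f p (Z p)) = g.inner p (g.leviCivita Y p (X p)) (Z p) := by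
  have hfp : ContMDiffAt I J ∞ f p := hf.smooth p
  have hm : ∀ {A B : Π p : M, TangentSpace I p} (u : TangentSpace I p),
      MDiffAt (T% A) p → MDiffAt (T% B) p →
      mvfderiv I (fun q => g.inner q (A q) (B q)) p u
        = gN.inner (f p) (covAlong I gN.leviCivita f (fun q => mfderiv I J f q (A q)) p u)
            (mfderiv I J f p (B p))
          + gN.inner (f p) (mfderiv I J f p (A p))
            (covAlong I gN.leviCivita f (fun q => mfderiv I J f q (B q)) p u) := by
    intro A B u hA hB
    simp only [← hf.inner_mfderiv]
    exact mvfderiv_inner_covAlong gN (mdifferentiableAt_mfderiv_apply hfp hA)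
      (mdifferentiableAt_mfderiv_apply hfp hB) u
  have ht : ∀ {A B : Π p : M, TangentSpace I p} (C : TangentSpace J (f p)),
      MDiffAt (T% A) p → MDiffAt (T% B) p →
      gN.inner (f p) (covAlong I gN.leviCivita f (fun q => mfderiv I J f q (B q)) p (A p)) C
        - gN.inner (f p) (covAlong I gN.leviCivita f (fun q => mfderiv I J f q (A q)) p (B p)) C
        = gN.inner (f p) (mfderiv I J f p (mlieBracket I A B p)) C := by
    intro A B C hA hB
    rw [← covAlong_mfderiv_sub gN.leviCivita gN.leviCivita_torsion hfp hA hB, map_sub, sub_apply]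
  change _ = g.inner p (g.leviCivitaFun Y p (X p)) (Z p)
  rw [g.leviCivitaFun_inner hX hY hZ, RiemMetric.koszul, hm _ hY hZ, hm _ hX hZ, hm _ hX hY,
    ← hf.inner_mfderiv, ← hf.inner_mfderiv, ← hf.inner_mfderiv, ← ht _ hX hY, ← ht _ hX hZ,
    ← ht _ hY hZ, gN.symm _ (mfderiv I J f p (Y p)), gN.symm _ (mfderiv I J f p (X p)),
    gN.symm _ (mfderiv I J f p (X p))]
  ring

/-- Neither connection has torsion, so antisymmetrizing either term gives `df [X, Y]`, and the
difference vanishes. -/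
theorem IsIsometricImmersion.secondFundForm_comm {g : RiemMetric I M} {gN : RiemMetric J N}
    {f : M → N} (hf : IsIsometricImmersion g gN f) {X Y : Π p : M, TangentSpace I p} {p : M}
    (hX : MDiffAt (T% X) p) (hY : MDiffAt (T% Y) p) :
    secondFundForm g gN f X Y p = secondFundForm g gN f Y X p := by
  have h1 := covAlong_mfderiv_sub gN.leviCivita gN.leviCivita_torsion (hf.smooth p) hX hY
  have h2 := (CovariantDerivative.torsion_eq_zero_iff (cov := g.leviCivita)).1
    g.leviCivita_torsion hX hY
  rw [← h2, map_sub] at h1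
  rw [secondFundForm, secondFundForm, ← sub_eq_zero]
  rw [← sub_eq_zero] at h1
  rw [← h1]
  abel

end Gauss

/-! ### The derivative of the structure fields on a generalized Kenmotsu manifold -/

section GeneralizedKenmotsu

variable {E : Type*} [NormedAddCommGroup E] [NormedSpace ℝ E]
  {H : Type*} [TopologicalSpace H] {I : ModelWithCorners ℝ E H}
  {M : Type*} [TopologicalSpace M] [ChartedSpace H M] [IsManifold I ∞ M]

theorem SmoothFieldAt.mdifferentiableAt {X : Π x : M, TangentSpace I x} {x : M}
    (hX : SmoothFieldAt I X x) : MDiffAt (T% X) x :=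
  ContMDiffAt.mdifferentiableAt hX (by simp)

theorem smoothFieldAt_extend {x : M} (u : TangentSpace I x) :
    SmoothFieldAt I (FiberBundle.extend E u) x :=
  FiberBundle.contMDiffAt_extend I E u

namespace MetricFStructure

variable {g : RiemMetric I M} {s n : ℕ} (S : MetricFStructure g s)

theorem smoothFieldAt_ξ (i : Fin s) (x : M) : SmoothFieldAt I (S.ξ i) x :=
  S.smooth_ξ i x

theorem smoothFieldAt_φ {Y : Π x : M, TangentSpace I x} {x : M} (hY : SmoothFieldAt I Y x) :
    SmoothFieldAt I (fun y => S.φ y (Y y)) x :=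
  ContMDiffAt.clm_bundle_apply (S.smooth_φ x) hY

theorem eq_zero_of_φ_eq_zero {x : M} {u : TangentSpace I x} (hφ : S.φ x u = 0)
    (hη : ∀ i, S.η i x u = 0) : u = 0 := by
  have h := S.φ_sq x u
  simpa [hφ, hη] using h

theorem fundForm_ξ_right (j : Fin s) (x : M) (u : TangentSpace I x) :
    S.fundForm x u (S.ξ j x) = 0 := by
  simp [fundForm, S.φ_ξ]

theorem fundForm_ξ_left (j : Fin s) (x : M) (u : TangentSpace I x) :
    S.fundForm x (S.ξ j x) u = 0 := by
  simp [fundForm, S.φ_skew, S.φ_ξ]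

variable {S}

namespace IsGeneralizedKenmotsu

/-- Since `ηⁱ(ξⱼ)` is constant, one of the two derivatives in `dηⁱ(ξⱼ, Y) = 0` drops out. -/
theorem η_mlieBracket_ξ (hS : S.IsGeneralizedKenmotsu n) (i j : Fin s)
    {Y : Π x : M, TangentSpace I x} {x : M} (hY : SmoothFieldAt I Y x) :
    S.η i x (mlieBracket I (S.ξ j) Y x) = mvfderiv I (fun y => S.η i y (Y y)) x (S.ξ j x) := by
  have h := hS.closed_η i x (S.ξ j) Y (S.smoothFieldAt_ξ j x) hY
  simp only [extDerivOne, S.η_ξ, mvfderiv_const, zero_apply] at h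
  linarith

/-- As `φ ξₖ = 0`, normality reduces to `φ² [ξᵢ, ξⱼ] = 0`; closedness makes every `ηᵏ [ξᵢ, ξⱼ]`
vanish, and the formula for `φ²` concludes. -/
theorem mlieBracket_ξ_ξ (hS : S.IsGeneralizedKenmotsu n) (i j : Fin s) (x : M) :
    mlieBracket I (S.ξ i) (S.ξ j) x = 0 := by
  have hη : ∀ k, S.η k x (mlieBracket I (S.ξ i) (S.ξ j) x) = 0 := fun k => by
    rw [hS.η_mlieBracket_ξ k i (S.smoothFieldAt_ξ j x)]
    simp [S.η_ξ, mvfderiv_const]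
  have h0 : ∀ k, (fun y => S.φ y (S.ξ k y)) = 0 := fun k => funext fun y => S.φ_ξ y k
  have h := hS.normal x _ _ (S.smoothFieldAt_ξ i x) (S.smoothFieldAt_ξ j x)
  simp only [nijenhuis, hS.closed_η _ x _ _ (S.smoothFieldAt_ξ i x) (S.smoothFieldAt_ξ j x), h0,
    mlieBracket_zero_left, mlieBracket_zero_right] at h
  have h1 := S.φ_sq x (mlieBracket I (S.ξ i) (S.ξ j) x)
  simp only [hη] at h1
  simpa [h1] using h

/-- This is `L_{ξⱼ} φ = 0`. Normality shows that `φ` kills the difference of the two sides,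
closedness that every `ηⁱ` does, and only zero has both properties. -/
theorem mlieBracket_ξ_φ (hS : S.IsGeneralizedKenmotsu n) (j : Fin s)
    {Y : Π x : M, TangentSpace I x} {x : M} (hY : SmoothFieldAt I Y x) :
    mlieBracket I (S.ξ j) (fun y => S.φ y (Y y)) x = S.φ x (mlieBracket I (S.ξ j) Y x) := by
  have h0 : (fun y => S.φ y (S.ξ j y)) = 0 := funext fun y => S.φ_ξ y j
  have h := hS.normal x _ _ (S.smoothFieldAt_ξ j x) hY
  simp only [nijenhuis, hS.closed_η _ x _ _ (S.smoothFieldAt_ξ j x) hY, h0,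
    mlieBracket_zero_left] at h
  refine (sub_eq_zero.1 (S.eq_zero_of_φ_eq_zero (x := x) ?_ fun i => ?_)).symm
  · simpa using h
  · rw [map_sub, S.η_φ, hS.η_mlieBracket_ξ i j (S.smoothFieldAt_φ hY)]
    simp [S.η_φ, mvfderiv_const]

/-- `(L_{ξⱼ} g)(Y, φ Z) = 2 g(Y, φ Z)`. -/
theorem lieDeriv_inner_φ (hS : S.IsGeneralizedKenmotsu n) (j : Fin s)
    {Y Z : Π x : M, TangentSpace I x} {x : M} (hY : SmoothFieldAt I Y x)
    (hZ : SmoothFieldAt I Z x) :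
    mvfderiv I (fun y => g.inner y (Y y) (S.φ y (Z y))) x (S.ξ j x)
        - g.inner x (mlieBracket I (S.ξ j) Y x) (S.φ x (Z x))
        - g.inner x (Y x) (mlieBracket I (S.ξ j) (fun y => S.φ y (Z y)) x)
      = 2 * g.inner x (Y x) (S.φ x (Z x)) := by
  have h := hS.d_fundForm x (S.ξ j) Y Z (S.smoothFieldAt_ξ j x) hY hZ
  -- Since `ξⱼ` is in the kernel of `Φ`, only `ηʲ(ξⱼ) Φ(Y, Z)` survives on the right. The factors `1
  -- / 3` on both sides agree, which leaves `L_{ξⱼ} Φ = 2Φ`.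
  simp only [extDerivTwo, wedgeOneTwo, S.fundForm_ξ_left, S.fundForm_ξ_right, mvfderiv_const,
    zero_apply, S.η_ξ, mul_zero, add_zero, sub_zero, ite_mul, one_mul, zero_mul, mul_ite,
    Finset.sum_ite_eq', Finset.mem_univ, if_true] at h
  rw [hS.mlieBracket_ξ_φ j hZ]
  rw [mlieBracket_swap_apply (V := Z)] at h
  simp only [fundForm] at h
  have h1 := S.φ_skew x (mlieBracket I (S.ξ j) Z x) (Y x)
  rw [g.symm x (S.φ x _)] at h1
  simp only [map_neg, neg_apply] at h
  linarith

/-- `(L_{ξⱼ} g)(Y, ξᵢ) = 0`. -/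
theorem lieDeriv_inner_ξ (hS : S.IsGeneralizedKenmotsu n) (i j : Fin s)
    {Y : Π x : M, TangentSpace I x} {x : M} (hY : SmoothFieldAt I Y x) :
    mvfderiv I (fun y => g.inner y (Y y) (S.ξ i y)) x (S.ξ j x)
        - g.inner x (mlieBracket I (S.ξ j) Y x) (S.ξ i x)
        - g.inner x (Y x) (mlieBracket I (S.ξ j) (S.ξ i) x) = 0 := by
  rw [hS.mlieBracket_ξ_ξ, ← S.η_eq_inner, hS.η_mlieBracket_ξ i j hY]
  simp [S.η_eq_inner]

variable [FiniteDimensional ℝ E]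

/-- The right side is `(L_{ξⱼ} g)(Y, Z)`. The other terms of Koszul's formula add up to a multiple
of `dηʲ(Y, Z)`, which is zero. -/
theorem inner_leviCivita_ξ (hS : S.IsGeneralizedKenmotsu n) (j : Fin s)
    {Y Z : Π x : M, TangentSpace I x} {x : M} (hY : SmoothFieldAt I Y x)
    (hZ : SmoothFieldAt I Z x) :
    2 * g.inner x (g.leviCivita (S.ξ j) x (Y x)) (Z x)
      = mvfderiv I (fun y => g.inner y (Y y) (Z y)) x (S.ξ j x)
        - g.inner x (mlieBracket I (S.ξ j) Y x) (Z x)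
        - g.inner x (Y x) (mlieBracket I (S.ξ j) Z x) := by
  change 2 * g.inner x (g.leviCivitaFun (S.ξ j) x (Y x)) (Z x) = _
  have h := hS.closed_η j x Y Z hY hZ
  simp only [extDerivOne, S.η_eq_inner] at h
  rw [g.leviCivitaFun_inner hY.mdifferentiableAt (S.smoothFieldAt_ξ j x).mdifferentiableAt
    hZ.mdifferentiableAt, RiemMetric.koszul, mlieBracket_swap_apply (V := Y) (W := S.ξ j),
    g.symm x (Y x)]
  simp only [g.symm _ (S.ξ j _), map_neg, neg_apply]
  linarith

theorem leviCivita_ξ (hS : S.IsGeneralizedKenmotsu n) (j : Fin s) (x : M) (u : TangentSpace I x) :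
    g.leviCivita (S.ξ j) x u = -S.φ x (S.φ x u) := by
  have hφ : ∀ z, g.inner x (g.leviCivita (S.ξ j) x u) (S.φ x z) = g.inner x u (S.φ x z) := by
    intro z
    have h := hS.inner_leviCivita_ξ j (smoothFieldAt_extend u)
      (S.smoothFieldAt_φ (smoothFieldAt_extend z))
    rw [hS.lieDeriv_inner_φ j (smoothFieldAt_extend u) (smoothFieldAt_extend z)] at h
    simpa using h
  have hξ : ∀ i, g.inner x (g.leviCivita (S.ξ j) x u) (S.ξ i x) = 0 := by
    intro i
    have h := hS.inner_leviCivita_ξ j (smoothFieldAt_extend u) (S.smoothFieldAt_ξ i x)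
    rw [hS.lieDeriv_inner_ξ i j (smoothFieldAt_extend u)] at h
    simpa using h
  refine g.ext_inner fun z => ?_
  -- This splits `z` into a vector in the image of `φ` and a combination of the `ξᵢ`, the two cases
  -- settled by `hφ` and `hξ`.
  have hz : z = -S.φ x (S.φ x z) + ∑ i, S.η i x z • S.ξ i x := by rw [S.φ_sq]; abel
  have h1 : g.inner x (g.leviCivita (S.ξ j) x u) z
      = -g.inner x u (S.φ x (S.φ x z)) := by
    conv_lhs => rw [hz]
    simp [hφ, hξ]
  rw [h1, S.φ_skew, map_neg, neg_apply, S.φ_skew, neg_neg]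

end IsGeneralizedKenmotsu

end MetricFStructure

end GeneralizedKenmotsu

/-! ### Descending differentiability through an immersion -/

section Immersion

variable {E : Type*} [NormedAddCommGroup E] [NormedSpace ℝ E]
  {H : Type*} [TopologicalSpace H] {I : ModelWithCorners ℝ E H}
  {M : Type*} [TopologicalSpace M] [ChartedSpace H M] [IsManifold I ∞ M]
  {E' : Type*} [NormedAddCommGroup E'] [NormedSpace ℝ E']
  {H' : Type*} [TopologicalSpace H'] {J : ModelWithCorners ℝ E' H'}
  {N : Type*} [TopologicalSpace N] [ChartedSpace H' N] [IsManifold J ∞ N]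

theorem exists_leftInverse_clm [FiniteDimensional ℝ E'] {L : E →L[ℝ] E'} (hL : Function.Injective L) :
    ∃ P : E' →L[ℝ] E, P ∘L L = ContinuousLinearMap.id ℝ E := by
  obtain ⟨P, hP⟩ := (L : E →ₗ[ℝ] E').exists_leftInverse_of_injective (LinearMap.ker_eq_bot.2 hL)
  refine ⟨LinearMap.toContinuousLinearMap P, ?_⟩
  ext x
  exact congr($hP x)

variable [FiniteDimensional ℝ E] [FiniteDimensional ℝ E']

/-- A vector field with differentiable image under an immersion is differentiable. -/
theorem mdifferentiableAt_of_mfderiv_apply {f : M → N} {p : M} (hf : ContMDiffAt I J ∞ f p)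
    (hinj : Function.Injective (mfderiv I J f p)) {V : Π x : M, TangentSpace I x}
    (hV : MDifferentiableAt I (J.prod 𝓘(ℝ, E'))
      (fun q => (TotalSpace.mk' E' (f q) (mfderiv I J f q (V q)) : TangentBundle J N)) p) :
    MDiffAt (T% V) p := by
  have := FiniteDimensional.complete ℝ E
  set e := trivializationAt E (fun y : M => TangentSpace I y) p with he
  set e' := trivializationAt E' (fun y : N => TangentSpace J y) (f p) with he'
  have hb : p ∈ e.baseSet := FiberBundle.mem_baseSet_trivializationAt' p
  have hb' : f p ∈ e'.baseSet := FiberBundle.mem_baseSet_trivializationAt' (f p)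
  set L : M → E →L[ℝ] E' := inTangentCoordinates I J id f (mfderiv I J f) p with hLdef
  have hL : MDifferentiableAt I 𝓘(ℝ, E →L[ℝ] E') L p :=
    (hf.mfderiv_const (m := 1) (by decide)).mdifferentiableAt one_ne_zero
  have hLa : ∀ q, q ∈ e.baseSet → f q ∈ e'.baseSet → ∀ u : TangentSpace I q,
      L q (e ⟨q, u⟩).2 = (e' ⟨f q, mfderiv I J f q u⟩).2 := by
    intro q hq hq' u
    have h1 : (trivializationAt E (TangentSpace I) p).symmL ℝ q (e.continuousLinearMapAt ℝ q u) = u :=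
      e.symmL_continuousLinearMapAt (R := ℝ) hq u
    rw [← Trivialization.continuousLinearMapAt_apply_of_mem (R := ℝ) e hq,
      ← Trivialization.continuousLinearMapAt_apply_of_mem (R := ℝ) e' hq']
    simp only [hLdef, inTangentCoordinates, ContinuousLinearMap.inCoordinates, id]
    exact congrArg _ (congrArg _ h1)
  have hLp : Function.Injective (L p) := by
    rw [injective_iff_map_eq_zero]
    intro a ha
    have h1 : (e ⟨p, e.symm p a⟩).2 = a := by rw [e.apply_mk_symm hb]
    have h2 : e.symm p a = 0 := by
      apply hinj
      rw [map_zero, ← e'.symm_apply_apply_mk hb' (mfderiv I J f p _), ← hLa p hb hb', h1, ha,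
        ← Trivialization.symmL_apply (R := ℝ) _ hb', map_zero]
    rw [← h1, h2, ← Trivialization.continuousLinearMapAt_apply_of_mem (R := ℝ) e hb, map_zero]
  -- `P` is a left inverse of `L` only at `p`, but `P ∘L L q` stays invertible nearby. The
  -- components of `V` are then `(P ∘L L q)⁻¹ P` applied to those of `df V`, and inversion is
  -- differentiable.
  obtain ⟨P, hP⟩ := exists_leftInverse_clm hLp
  have hPL : MDifferentiableAt I 𝓘(ℝ, E →L[ℝ] E) (fun q => P ∘L L q) p :=
    ((ContinuousLinearMap.compL ℝ E E' E P).differentiableAt.mdifferentiableAt).comp p hL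
  have hinv : MDifferentiableAt I 𝓘(ℝ, E →L[ℝ] E) (fun q => Ring.inverse (P ∘L L q)) p := by
    refine MDifferentiableAt.comp (g := Ring.inverse) p ?_ hPL
    rw [hP]
    exact (differentiableAt_inverse (𝕜 := ℝ) (R := E →L[ℝ] E) isUnit_one).mdifferentiableAt
  have hunit : ∀ᶠ q in 𝓝 p, IsUnit (P ∘L L q) := by
    refine hPL.continuousAt.eventually (Units.isOpen.mem_nhds ?_)
    change IsUnit (P ∘L L p)
    rw [hP]
    exact isUnit_one
  rw [mdifferentiableAt_totalSpace] at hV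
  have hw : MDifferentiableAt I 𝓘(ℝ, E) (fun q => P (e' ⟨f q, mfderiv I J f q (V q)⟩).2) p :=
    (P.differentiableAt.mdifferentiableAt).comp p hV.2
  rw [mdifferentiableAt_section]
  refine (hinv.clm_apply hw).congr_of_eventuallyEq ?_
  filter_upwards [hunit, e.open_baseSet.mem_nhds hb,
    hf.continuousAt.eventually (e'.open_baseSet.mem_nhds hb')] with q hq1 hq2 hq3
  rw [← hLa q hq2 hq3]
  exact congr($((Ring.inverse_mul_cancel _ hq1).symm) (e ⟨q, V q⟩).2)

end Immersion

/-! ### Invariant submanifolds -/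

section InvariantSubmanifold

variable {E : Type*} [NormedAddCommGroup E] [NormedSpace ℝ E]
  {H : Type*} [TopologicalSpace H] {I : ModelWithCorners ℝ E H}
  {M : Type*} [TopologicalSpace M] [ChartedSpace H M]
  {E' : Type*} [NormedAddCommGroup E'] [NormedSpace ℝ E']
  {H' : Type*} [TopologicalSpace H'] {J : ModelWithCorners ℝ E' H'}
  {N : Type*} [TopologicalSpace N] [ChartedSpace H' N] [IsManifold J ∞ N]

namespace MetricFStructure

variable {gN : RiemMetric J N} {s : ℕ} {S : MetricFStructure gN s} {f : M → N}

theorem IsInvariant.mfderiv_φ (h : S.IsInvariant I f) (p : M) (u : TangentSpace I p) :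
    mfderiv I J f p (h.φ p u) = S.φ (f p) (mfderiv I J f p u) :=
  (h.φ_tangent p u).choose_spec

theorem IsInvariant.mfderiv_ξ (h : S.IsInvariant I f) (i : Fin s) (p : M) :
    mfderiv I J f p (h.ξ i p) = S.ξ i (f p) :=
  (h.ξ_tangent i p).choose_spec

variable [IsManifold I ∞ M] [FiniteDimensional ℝ E] [FiniteDimensional ℝ E'] {g : RiemMetric I M}

/-- The field is chosen point by point, so its regularity must be recovered from its image `ξⱼ ∘ f`
under `df`. -/
theorem IsInvariant.mdifferentiableAt_ξ (hf : IsIsometricImmersion g gN f) (h : S.IsInvariant I f)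
    (j : Fin s) (p : M) : MDiffAt (T% (h.ξ j)) p := by
  refine mdifferentiableAt_of_mfderiv_apply (hf.smooth p) (hf.mfderiv_injective p) ?_
  simp only [h.mfderiv_ξ]
  exact MDifferentiableAt.comp p (S.smoothFieldAt_ξ j (f p)).mdifferentiableAt
    ((hf.smooth p).mdifferentiableAt (by simp))

theorem IsGeneralizedKenmotsu.leviCivita_ξ_of_isInvariant {n : ℕ} (hS : S.IsGeneralizedKenmotsu n)
    (hf : IsIsometricImmersion g gN f) (h : S.IsInvariant I f) {X : Π p : M, TangentSpace I p}
    {p : M} (hX : SmoothFieldAt I X p) (j : Fin s) :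
    g.leviCivita (h.ξ j) p (X p) = -h.φ p (h.φ p (X p)) ∧
      secondFundForm g gN f X (h.ξ j) p = 0 ∧ secondFundForm g gN f (h.ξ j) X p = 0 := by
  have hfp := hf.smooth p
  have hξf : (fun q => mfderiv I J f q (h.ξ j q)) = fun q => S.ξ j (f q) :=
    funext fun q => h.mfderiv_ξ j q
  have hξN := (S.smoothFieldAt_ξ j (f p)).mdifferentiableAt
  have hξ := h.mdifferentiableAt_ξ hf j p
  have hcov : covAlong I gN.leviCivita f
      (fun q => mfderiv I J f q (h.ξ j q)) p (X p)
      = mfderiv I J f p (-h.φ p (h.φ p (X p))) := by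
    rw [hξf, covAlong_comp _ (hfp.mdifferentiableAt (by simp)) hξN, hS.leviCivita_ξ, map_neg,
      h.mfderiv_φ, h.mfderiv_φ]
  -- By `hcov` the ambient derivative is tangent, so its scalar products with tangent vectors
  -- determine it.
  have hLC : g.leviCivita (h.ξ j) p (X p) = -h.φ p (h.φ p (X p)) := by
    refine g.ext_inner fun z => ?_
    have h1 := hf.inner_covAlong hX.mdifferentiableAt hξ
      (FiberBundle.mdifferentiableAt_extend I E z)
    rw [hcov, hf.inner_mfderiv, FiberBundle.extend_apply_self] at h1
    exact h1.symm
  have h2 : secondFundForm g gN f X (h.ξ j) p = 0 := by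
    rw [secondFundForm, hcov, hLC, sub_self]
  exact ⟨hLC, h2, (hf.secondFundForm_comm hX.mdifferentiableAt hξ).symm.trans h2⟩

end MetricFStructure

end InvariantSubmanifold

theorem mainTheorem5 {n s m : ℕ}
    {N : Type*} [TopologicalSpace N] [ChartedSpace (EuclideanSpace ℝ (Fin (2 * n + s))) N]
    [IsManifold (𝓡 (2 * n + s)) ∞ N]
    (gN : RiemMetric (𝓡 (2 * n + s)) N) (S : MetricFStructure gN s)
    (hS : S.IsGeneralizedKenmotsu n)
    {M : Type*} [TopologicalSpace M] [ChartedSpace (EuclideanSpace ℝ (Fin m)) M]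
    [IsManifold (𝓡 m) ∞ M]
    (g : RiemMetric (𝓡 m) M) (f : M → N) (hf : IsIsometricImmersion g gN f)
    (hinv : S.IsInvariant (𝓡 m) f)
    (X : Π p : M, TangentSpace (𝓡 m) p) (p : M) (hX : SmoothFieldAt (𝓡 m) X p) (j : Fin s) :
    g.leviCivita (hinv.ξ j) p (X p) = -hinv.φ p (hinv.φ p (X p)) ∧
      secondFundForm g gN f X (hinv.ξ j) p = 0 ∧
      secondFundForm g gN f (hinv.ξ j) X p = 0 := by
  exact hS.leviCivita_ξ_of_isInvariant hf hinv hX j
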